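/- **Setting.** Let $n\in\mathbb N$, $N=\{1,\dots,n\}$. Let $\alpha\ge 0$ and $\mu>0$ (entrywise) be row vectors in $\mathbb R^n$, and let $P=(p_{ij})$ and $Q=(q_{ij})$ be substochastic $n\times n$ matrices (nonnegative entries, row sums at most $1$). For an $n\times n$ matrix $M$ and $A\subseteq N$ let $M_A$ denote $M$ with all rows $i\notin A$ replaced by zero rows, and let $\rho$ denote the spectral radius; minima and maxima of vectors are taken entrywise. Nodes $i,j$ communicate if $i=j$ or if $(P^k)_{ij}>0$ and $(P^l)_{ji}>0$ for some $k,l\ge 0$; the equivalence classes are the communicating classes of $P$. A class $C$ can be filled if there are $i\in N$, $j\in C$ and $k\ge 0$ with $\alpha_i>0$ and $(P^k)_{ij}>0$; it can be drained if some $i\in C$ has $\sum_{j}p_{ij}<1$ or has $p_{ij}>0$ for some $j\notin C$. The network $(\alpha,\mu,P)$ is NI (non-isolated) if every communicating class can be filled or drained; in that case the equation $\lambda=\alpha+\min(\lambda,\mu)P$ has a unique solution $\lambda^*$, which is nonnegative, and we put $U^*=\{i\in N:\lambda^*_i\ge\mu_i\}$. **Overflow algorithm.** Put $U:=\emptyset$.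 Outer loop: put $S:=\emptyset$ and run the inner loop. An iteration of the inner loop solves the linear equation $$\lambda=\alpha+\mu P_{N\setminus S}+\lambda P_S+(\lambda-\mu)Q_U$$ for $\lambda$ and puts $S':=\{i\in N\setminus U:\lambda_i<\mu_i\}$; if $S'\ne S$, replace $S$ by $S'$ and repeat the inner loop, otherwise leave it with the vector $\lambda$ just computed. Then put $U':=\{i\in N:\lambda_i\ge\mu_i\}$; if $U'\neq U$, replace $U$ by $U'$ and repeat the outer loop, otherwise stop and return $\lambda$. The number of iterations is the total number of iterations of the inner loop, that is, of linear equations solved. **Theorem 2.** Assume that $(\alpha,\mu,P)$ is NI and that $\rho(P_A+Q_{N\setminus A})<1$ for every $A\subseteq N\setminus U^*$. Then the overflow traffic equation $$\lambda=\alpha+\min(\lambda,\mu)P+\max(\lambda-\mu,0)Q$$ has exactly one solution $\lambda\in\mathbb R^n$, and this solution is nonnegative. The overflow algorithm terminates and returns this solution after at most $1+\frac{n(n+1)}2$ iterations, hence after at most $n^2$ iterations if $n\ge 2$. Each iteration consists of solving a linear equation in $n$ variables that has a unique solution. -/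

import Mathlib

open Matrix

namespace OverflowNetwork

variable {n : ℕ}

/-- Nonnegative entries and all row sums at most `1`. -/
def IsSubstochastic (P : Matrix (Fin n) (Fin n) ℝ) : Prop :=
  (∀ i j, 0 ≤ P i j) ∧ ∀ i, ∑ j, P i j ≤ 1

/-- The matrix `P_A`: the rows of `P` with index outside `A` are replaced by zero rows. -/
def restrictRows (P : Matrix (Fin n) (Fin n) ℝ) (A : Finset (Fin n)) :
    Matrix (Fin n) (Fin n) ℝ :=
  Matrix.of fun i j => if i ∈ A then P i j else 0

/-- The spectral radius of a real square matrix: the largest modulus of a complex eigenvalue. -/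
noncomputable def specRad (M : Matrix (Fin n) (Fin n) ℝ) : ENNReal :=
  spectralRadius ℂ (M.map (fun t : ℝ => (t : ℂ)))

/-- Two nodes communicate if they are equal or each is reachable from the other. -/
def Communicate (P : Matrix (Fin n) (Fin n) ℝ) (i j : Fin n) : Prop :=
  i = j ∨ ((∃ k : ℕ, 0 < (P ^ k) i j) ∧ ∃ l : ℕ, 0 < (P ^ l) j i)

/-- The communicating classes of `P`. -/
def IsCommunicatingClass (P : Matrix (Fin n) (Fin n) ℝ) (C : Set (Fin n)) : Prop :=
  ∃ i, C = {j | Communicate P i j}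

def CanBeFilled (α : Fin n → ℝ) (P : Matrix (Fin n) (Fin n) ℝ) (C : Set (Fin n)) : Prop :=
  (∃ i ∈ C, 0 < α i) ∨ ∃ i, 0 < α i ∧ ∃ j ∈ C, ∃ k : ℕ, 0 < (P ^ k) i j

def ExternallyDrained (P : Matrix (Fin n) (Fin n) ℝ) (C : Set (Fin n)) : Prop :=
  ∃ i ∈ C, ∑ j, P i j < 1

def InternallyDrained (P : Matrix (Fin n) (Fin n) ℝ) (C : Set (Fin n)) : Prop :=
  ∃ i ∈ C, ∃ j, j ∉ C ∧ 0 < P i j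

def CanBeDrained (P : Matrix (Fin n) (Fin n) ℝ) (C : Set (Fin n)) : Prop :=
  ExternallyDrained P C ∨ InternallyDrained P C

def Isolated (α : Fin n → ℝ) (P : Matrix (Fin n) (Fin n) ℝ) (C : Set (Fin n)) : Prop :=
  ¬ CanBeFilled α P C ∧ ¬ CanBeDrained P C

/-- The network without overflows is non-isolated: no communicating class is isolated. -/
def NonIsolated (α : Fin n → ℝ) (P : Matrix (Fin n) (Fin n) ℝ) : Prop :=
  ∀ C, IsCommunicatingClass P C → ¬ Isolated α P C

/-- The Goodman--Massey traffic equation `x = α + min(x, μ) P`. -/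
def GoodmanMasseyEq (α μ : Fin n → ℝ) (P : Matrix (Fin n) (Fin n) ℝ) (x : Fin n → ℝ) : Prop :=
  x = α + (x ⊓ μ) ᵥ* P

/-- The overflow traffic equation `x = α + min(x, μ) P + max(x - μ, 0) Q`. -/
def OverflowEq (α μ : Fin n → ℝ) (P Q : Matrix (Fin n) (Fin n) ℝ) (x : Fin n → ℝ) : Prop :=
  x = α + (x ⊓ μ) ᵥ* P + ((x - μ) ⊔ 0) ᵥ* Q

/-- The set of nodes `i` with `x i ≥ μ i`. -/
noncomputable def overloaded (μ x : Fin n → ℝ) : Finset (Fin n) :=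
  Finset.univ.filter fun i => μ i ≤ x i

/-- The network without overflows is non-isolated, and `P_A + Q_{N \ A}` has spectral radius
less than one for every set `A` of nodes that avoids the overloaded nodes of the solution of
the Goodman--Massey equation. -/
def OverflowCondition (α μ : Fin n → ℝ) (P Q : Matrix (Fin n) (Fin n) ℝ) : Prop :=
  NonIsolated α P ∧
    ∀ x, GoodmanMasseyEq α μ P x →
      ∀ A : Finset (Fin n), A ⊆ (overloaded μ x)ᶜ →
        specRad (restrictRows P A + restrictRows Q Aᶜ) < 1

/-- The linear equation in the unknown `x` that one iteration of the algorithm solves: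
`x = α + μ P_{N \ S} + x P_S + (x - μ) Q_B`. -/
def LinearEq (α μ : Fin n → ℝ) (P Q : Matrix (Fin n) (Fin n) ℝ) (S B : Finset (Fin n))
    (x : Fin n → ℝ) : Prop :=
  x = α + μ ᵥ* restrictRows P Sᶜ + x ᵥ* restrictRows P S + (x - μ) ᵥ* restrictRows Q B

/-- The set `{i ∈ N \ U : x i < μ i}` computed at the end of an iteration of the inner loop. -/
noncomputable def stableOutside (μ : Fin n → ℝ) (U : Finset (Fin n)) (x : Fin n → ℝ) :
    Finset (Fin n) :=
  Uᶜ.filter fun i => x i < μ i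

/-- The configurations of the overflow algorithm between two iterations of the inner loop:
either it is running, with current value `U` of the outer-loop set and current value `S` of the
inner-loop set, or it has returned a vector. -/
inductive Config (n : ℕ) : Type
  | running (U S : Finset (Fin n)) : Config n
  | returned (x : Fin n → ℝ) : Config n

/-- One iteration of the inner loop of the overflow algorithm, together with the tests at the end
of the two nested repeat loops: solve the linear equation based on `S` and `B = U`, obtaining some
solution `x`, and compute the new inner-loop set. If it changed, the inner loop is repeated.
If not, the inner loop ends and the new outer-loop set is `overloaded μ x`: if that set changed,
the outer loop is repeated, with the inner-loop set reset to the empty set; if not, `x` is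
returned. -/
inductive Step (α μ : Fin n → ℝ) (P Q : Matrix (Fin n) (Fin n) ℝ) : Config n → Config n → Prop
  | inner (U S : Finset (Fin n)) (x : Fin n → ℝ) (hx : LinearEq α μ P Q S U x)
      (hS : stableOutside μ U x ≠ S) :
      Step α μ P Q (Config.running U S) (Config.running U (stableOutside μ U x))
  | outer (U S : Finset (Fin n)) (x : Fin n → ℝ) (hx : LinearEq α μ P Q S U x)
      (hS : stableOutside μ U x = S) (hU : overloaded μ x ≠ U) :
      Step α μ P Q (Config.running U S) (Config.running (overloaded μ x) ∅)
  | halt (U S : Finset (Fin n)) (x : Fin n → ℝ) (hx : LinearEq α μ P Q S U x)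
      (hS : stableOutside μ U x = S) (hU : overloaded μ x = U) :
      Step α μ P Q (Config.running U S) (Config.returned x)

/-- `RunsTo α μ P Q k c`: some execution of the overflow algorithm, started with both sets empty,
is in configuration `c` after exactly `k` iterations (linear equations solved). -/
inductive RunsTo (α μ : Fin n → ℝ) (P Q : Matrix (Fin n) (Fin n) ℝ) : ℕ → Config n → Prop
  | start : RunsTo α μ P Q 0 (Config.running ∅ ∅)
  | step (k : ℕ) (c c' : Config n) (hc : RunsTo α μ P Q k c) (h : Step α μ P Q c c') :
      RunsTo α μ P Q (k + 1) c'

end OverflowNetwork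

/-! The spectral radius is used only through an order property of nonnegative `M`: no nonzero `y ≥
0` satisfies `y ≤ y M`. Gelfand's formula supplies this property. It passes to transposes and to
entrywise smaller matrices, and it gives unique solvability and comparison for `x = b + x M`.

Existence comes from the algorithm itself, through `Invariant`. Within an inner loop the solutions
decrease, so `S` grows. Across outer passes, the last vector is a subsolution of the overflow
equation, so comparison makes `U` grow. The spectral condition speaks of Goodman–Massey solutions,
and none is known at the start. The first pass, with `U = ∅`, therefore rests on a mass balance
(`subinvariantTrivial_restrictRows_of_lt`) and ends with such a solution `g`. Afterwards the
overloaded nodes of `g` lie in `U`, so the condition applies. Since `S` and the next `U` are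
disjoint, the sizes of these growing sets yield the iteration bound.

For uniqueness, non-isolation gives `g ≤ x` for every overflow solution `x`
(`GoodmanMasseyEq.le_of_overflowEq`). Two solutions thus both exceed `μ` where `g` is overloaded.
Their absolute difference is subinvariant for a row-wise mixture of `P` and `Q` that uses only `Q`
on those rows, and `subinvariantTrivial_mixture` makes it vanish. -/

namespace OverflowNetwork

variable {n : ℕ}

/-! ### Subinvariant vectors and the spectral radius -/

/-- The only nonnegative row vector `y` with `y ≤ y M` is zero. For nonnegative `M` this says that
the spectral radius of `M` is less than one. -/
def SubinvariantTrivial (M : Matrix (Fin n) (Fin n) ℝ) : Prop :=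
  ∀ y : Fin n → ℝ, (∀ i, 0 ≤ y i) → (∀ j, y j ≤ ∑ i, y i * M i j) → ∀ i, y i = 0

/-- Since `M ≥ 0`, the positive part of a subinvariant vector is again subinvariant. This is the
source of all comparisons of linear solutions below. -/
theorem SubinvariantTrivial.nonpos {M : Matrix (Fin n) (Fin n) ℝ} (hM : SubinvariantTrivial M)
    (h0 : ∀ i j, 0 ≤ M i j) {d : Fin n → ℝ} (hd : ∀ j, d j ≤ ∑ i, d i * M i j) (j : Fin n) :
    d j ≤ 0 := by
  have h := hM (fun i => max (d i) 0) (fun i => le_max_right _ _) (fun j => by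
    apply max_le
    · exact (hd j).trans (Finset.sum_le_sum fun i _ =>
        mul_le_mul_of_nonneg_right (le_max_left _ _) (h0 i j))
    · exact Finset.sum_nonneg fun i _ => mul_nonneg (le_max_right _ _) (h0 i j)) j
  exact max_eq_right_iff.mp h

theorem SubinvariantTrivial.mono {M M' : Matrix (Fin n) (Fin n) ℝ} (hM : SubinvariantTrivial M)
    (h : ∀ i j, M' i j ≤ M i j) : SubinvariantTrivial M' := fun y hy hyM =>
  hM y hy fun j => (hyM j).trans (Finset.sum_le_sum fun i _ =>
    mul_le_mul_of_nonneg_left (h i j) (hy i))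

theorem SubinvariantTrivial.existsUnique {M : Matrix (Fin n) (Fin n) ℝ}
    (hM : SubinvariantTrivial M) (h0 : ∀ i j, 0 ≤ M i j) (b : Fin n → ℝ) :
    ∃! x : Fin n → ℝ, ∀ j, x j = b j + ∑ i, x i * M i j := by
  have hinj : Function.Injective
      (LinearMap.id - Matrix.vecMulLinear M : (Fin n → ℝ) →ₗ[ℝ] (Fin n → ℝ)) := by
    rw [← LinearMap.ker_eq_bot, LinearMap.ker_eq_bot']
    intro y hy
    have hy' : ∀ j, y j = ∑ i, y i * M i j := fun j => by
      have := congrFun hy j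
      simp only [LinearMap.sub_apply, LinearMap.id_apply, Matrix.vecMulLinear_apply,
        Pi.sub_apply, Pi.zero_apply, Matrix.vecMul, dotProduct] at this
      linarith
    funext j
    have h1 := hM.nonpos h0 (fun j => (hy' j).le) j
    have h2 := hM.nonpos (d := fun i => - y i) h0 (fun j => by
      simp only [neg_mul, Finset.sum_neg_distrib]
      exact neg_le_neg (hy' j).ge) j
    simp only [Pi.zero_apply]
    linarith
  have hsurj := LinearMap.injective_iff_surjective.mp hinj
  have key : ∀ x : Fin n → ℝ, (LinearMap.id - Matrix.vecMulLinear M : (Fin n → ℝ) →ₗ[ℝ] (Fin n → ℝ)) x = b ↔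
      ∀ j, x j = b j + ∑ i, x i * M i j := by
    intro x
    rw [funext_iff]
    refine forall_congr' fun j => ?_
    simp only [LinearMap.sub_apply, LinearMap.id_apply, Matrix.vecMulLinear_apply,
      Pi.sub_apply, Matrix.vecMul, dotProduct]
    exact sub_eq_iff_eq_add
  obtain ⟨x, hx⟩ := hsurj b
  exact ⟨x, (key x).mp hx, fun y hy => hinj (((key y).mpr hy).trans hx.symm)⟩

/-- Solve `z = 1 + M z` with `z ≥ 0` and pair it with `y ≤ y M`: then `y·z ≤ y·(z - 1)`, so the
entries of `y` sum to at most zero. -/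
theorem SubinvariantTrivial.of_transpose {M : Matrix (Fin n) (Fin n) ℝ}
    (hM : SubinvariantTrivial Mᵀ) (h0 : ∀ i j, 0 ≤ M i j) : SubinvariantTrivial M := by
  intro y hy hyM
  obtain ⟨z, hz, -⟩ := hM.existsUnique (fun i j => h0 j i) (fun _ => 1)
  have hz0 : ∀ i, 0 ≤ z i := fun i => by
    have := hM.nonpos (d := fun i => - z i) (fun i j => h0 j i) (fun j => by
      simp only [neg_mul, Finset.sum_neg_distrib]
      linarith [hz j]) i
    linarith
  have h1 : ∑ j, y j * z j ≤ ∑ j, (∑ i, y i * M i j) * z j :=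
    Finset.sum_le_sum fun j _ => mul_le_mul_of_nonneg_right (hyM j) (hz0 j)
  have h2 : ∑ j, (∑ i, y i * M i j) * z j = ∑ i, y i * (z i - 1) := by
    simp only [Finset.sum_mul]
    rw [Finset.sum_comm]
    refine Finset.sum_congr rfl fun i _ => ?_
    rw [hz i, add_sub_cancel_left, Finset.mul_sum]
    exact Finset.sum_congr rfl fun j _ => by rw [Matrix.transpose_apply]; ring
  have h3 : ∑ i, y i ≤ 0 := by
    rw [h2] at h1
    simp only [mul_sub, mul_one, Finset.sum_sub_distrib] at h1
    linarith
  have h4 := (Finset.sum_eq_zero_iff_of_nonneg fun i _ => hy i).mp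
    (le_antisymm h3 (Finset.sum_nonneg fun i _ => hy i))
  exact fun i => h4 i (Finset.mem_univ i)

section

attribute [local instance] Matrix.linftyOpNormedRing Matrix.linftyOpNormedAlgebra

theorem norm_apply_le_linftyOpNorm (A : Matrix (Fin n) (Fin n) ℂ) (i j : Fin n) :
    ‖A i j‖ ≤ ‖A‖ := by
  rw [Matrix.linfty_opNorm_def, ← coe_nnnorm, NNReal.coe_le_coe]
  exact (Finset.single_le_sum (f := fun j => ‖A i j‖₊) (fun _ _ => zero_le)
    (Finset.mem_univ j)).trans
      (Finset.le_sup (f := fun i => ∑ j, ‖A i j‖₊) (Finset.mem_univ i))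

/-- By Gelfand's formula, `‖M ^ k‖ ≤ r ^ k` eventually, for some `r < 1`. -/
theorem tendsto_pow_apply_of_specRad_lt_one {M : Matrix (Fin n) (Fin n) ℝ} (h : specRad M < 1)
    (i j : Fin n) :
    Filter.Tendsto (fun k : ℕ => (M ^ k) i j) Filter.atTop (nhds 0) := by
  have hG := spectrum.pow_nnnorm_pow_one_div_tendsto_nhds_spectralRadius
    (M.map (fun t : ℝ => (t : ℂ)))
  obtain ⟨r, hr1, hr2⟩ := exists_between h
  have hev := hG.eventually (gt_mem_nhds hr1)
  have hr : r ≠ ⊤ := (hr2.trans ENNReal.one_lt_top).ne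
  lift r to NNReal using hr
  have hr' : r < 1 := by exact_mod_cast hr2
  refine squeeze_zero_norm' ?_
    (tendsto_pow_atTop_nhds_zero_of_lt_one r.2 (by exact_mod_cast hr'))
  filter_upwards [hev, Filter.eventually_gt_atTop 0] with k hk hk0
  have hk1 : (k : ℝ) ≠ 0 := by exact_mod_cast hk0.ne'
  have := ENNReal.rpow_le_rpow hk.le (Nat.cast_nonneg k : (0 : ℝ) ≤ k)
  rw [← ENNReal.rpow_mul, one_div_mul_cancel hk1, ENNReal.rpow_one, ENNReal.rpow_natCast] at this
  have hnorm : ‖(M.map (fun t : ℝ => (t : ℂ))) ^ k‖ ≤ (r : ℝ) ^ k := by exact_mod_cast this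
  refine le_trans ?_ ((norm_apply_le_linftyOpNorm _ i j).trans hnorm)
  have : (M.map (fun t : ℝ => (t : ℂ))) ^ k = (M ^ k).map (fun t : ℝ => (t : ℂ)) :=
    (map_pow (Complex.ofRealHom.mapMatrix : Matrix (Fin n) (Fin n) ℝ →+* _) M k).symm
  simp [this]

end

/-- Iterating `v ≤ M v` gives `v ≤ M ^ k v`, and the right side tends to zero. -/
theorem subinvariantTrivial_transpose_of_specRad_lt_one {M : Matrix (Fin n) (Fin n) ℝ}
    (h0 : ∀ i j, 0 ≤ M i j) (h : specRad M < 1) : SubinvariantTrivial Mᵀ := by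
  intro v hv hvM
  have hM : ∀ i, v i ≤ (M *ᵥ v) i := fun i => by
    simpa [Matrix.mulVec, dotProduct, mul_comm] using hvM i
  have hk : ∀ k : ℕ, ∀ i, v i ≤ (M ^ k *ᵥ v) i := by
    intro k
    induction k with
    | zero => simp
    | succ k ih =>
      intro i
      rw [pow_succ', ← Matrix.mulVec_mulVec]
      refine (hM i).trans ?_
      change ∑ j, M i j * v j ≤ ∑ j, M i j * (M ^ k *ᵥ v) j
      exact (Finset.sum_le_sum fun j _ =>
        mul_le_mul_of_nonneg_left (ih j) (h0 i j))
  intro i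
  refine le_antisymm ?_ (hv i)
  have ht := tendsto_finsetSum Finset.univ fun j _ =>
    (tendsto_pow_apply_of_specRad_lt_one h i j).mul_const (v j)
  simp only [zero_mul, Finset.sum_const_zero] at ht
  exact ge_of_tendsto' ht fun k => hk k i

theorem restrictRows_apply (P : Matrix (Fin n) (Fin n) ℝ) (A : Finset (Fin n)) (i j : Fin n) :
    restrictRows P A i j = if i ∈ A then P i j else 0 := rfl

theorem restrictRows_add_nonneg {P Q : Matrix (Fin n) (Fin n) ℝ} (hP : ∀ i j, 0 ≤ P i j)
    (hQ : ∀ i j, 0 ≤ Q i j) (A B : Finset (Fin n)) (i j : Fin n) :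
    0 ≤ (restrictRows P A + restrictRows Q B) i j := by
  simp only [Matrix.add_apply, restrictRows_apply]
  have := hP i j
  have := hQ i j
  split_ifs <;> simp [*, add_nonneg]

/-- If all row-wise selections from `P` and `Q` that take the rows in `B` from `Q` have spectral
radius less than one, then so have the row-wise convex combinations. -/
theorem subinvariantTrivial_mixture {P Q : Matrix (Fin n) (Fin n) ℝ} (hP : ∀ i j, 0 ≤ P i j)
    (hQ : ∀ i j, 0 ≤ Q i j) {B : Finset (Fin n)}
    (h : ∀ A : Finset (Fin n), A ⊆ Bᶜ →
      SubinvariantTrivial (restrictRows P A + restrictRows Q Aᶜ)ᵀ)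
    {θ : Fin n → ℝ} (hθ0 : ∀ i, 0 ≤ θ i) (hθ1 : ∀ i, θ i ≤ 1) (hθB : ∀ i ∈ B, θ i = 0) :
    SubinvariantTrivial (Matrix.of fun i j => θ i * P i j + (1 - θ i) * Q i j) := by
  apply SubinvariantTrivial.of_transpose
  swap
  · intro i j
    exact add_nonneg (mul_nonneg (hθ0 i) (hP i j))
      (mul_nonneg (sub_nonneg.mpr (hθ1 i)) (hQ i j))
  intro v hv hvM
  -- Greedy choice: each row outside `B` takes whichever of `P v` and `Q v` is larger, which
  -- dominates any convex combination. Rows in `B` have weight zero on `P` anyway.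
  set A : Finset (Fin n) := Bᶜ.filter fun i => ∑ j, v j * Q i j ≤ ∑ j, v j * P i j with hA
  refine h A (Finset.filter_subset _ _) v hv fun i => (hvM i).trans ?_
  have e : ∑ j, v j * (Matrix.of fun i j => θ i * P i j + (1 - θ i) * Q i j)ᵀ j i
      = θ i * ∑ j, v j * P i j + (1 - θ i) * ∑ j, v j * Q i j := by
    rw [Finset.mul_sum, Finset.mul_sum, ← Finset.sum_add_distrib]
    exact Finset.sum_congr rfl fun j _ => by
      simp only [Matrix.transpose_apply, Matrix.of_apply]; ring
  rw [e]
  have h0 := hθ0 i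
  have h1 := hθ1 i
  simp only [Matrix.transpose_apply, Matrix.add_apply, restrictRows_apply, Finset.mem_compl]
  by_cases hi : i ∈ A
  · simp only [hi, not_true_eq_false, if_true, if_false, add_zero]
    have := (Finset.mem_filter.mp hi).2
    nlinarith
  · simp only [hi, not_false_eq_true, if_true, if_false, zero_add]
    by_cases hB : i ∈ B
    · simp [hθB i hB]
    · have : ∑ j, v j * P i j < ∑ j, v j * Q i j := by
        by_contra hc
        exact hi (Finset.mem_filter.mpr ⟨Finset.mem_compl.mpr hB, not_lt.mp hc⟩)
      nlinarith

/-! ### Mass balance for substochastic matrices -/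

/-- A subinvariant nonnegative row vector of a substochastic matrix is invariant, and its support
is a closed set of rows with sum one. -/
theorem IsSubstochastic.support_of_subinvariant {P : Matrix (Fin n) (Fin n) ℝ}
    (hP : IsSubstochastic P) {y : Fin n → ℝ} (hy : ∀ i, 0 ≤ y i)
    (hyP : ∀ j, y j ≤ ∑ i, y i * P i j) :
    (∀ j, y j = ∑ i, y i * P i j) ∧
      ∀ i, 0 < y i → ∑ j, P i j = 1 ∧ ∀ j, 0 < P i j → 0 < y j := by
  have hsum : ∑ j, ∑ i, y i * P i j = ∑ i, y i * ∑ j, P i j := by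
    rw [Finset.sum_comm]
    exact Finset.sum_congr rfl fun i _ => (Finset.mul_sum _ _ _).symm
  have h1 : ∑ j, y j ≤ ∑ j, ∑ i, y i * P i j := Finset.sum_le_sum fun j _ => hyP j
  have hle : ∀ i ∈ Finset.univ, y i * ∑ j, P i j ≤ y i := fun i _ =>
    mul_le_of_le_one_right (hy i) (hP.2 i)
  have h2 : ∑ i, y i * ∑ j, P i j ≤ ∑ i, y i := Finset.sum_le_sum hle
  -- The total masses satisfy `∑ y ≤ ∑ y P ≤ ∑ y`, so every termwise inequality is an equality.
  have e1 := (Finset.sum_eq_sum_iff_of_le fun j _ => hyP j).mp (by linarith)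
  have e2 := (Finset.sum_eq_sum_iff_of_le hle).mp (by linarith)
  refine ⟨fun j => e1 j (Finset.mem_univ j), fun i hi => ⟨?_, fun j hj => ?_⟩⟩
  · have := e2 i (Finset.mem_univ i)
    exact mul_left_cancel₀ hi.ne' (by rw [this, mul_one])
  · exact (mul_pos hi hj).trans_le ((Finset.single_le_sum (f := fun i => y i * P i j)
      (fun i _ => mul_nonneg (hy i) (hP.1 i j)) (Finset.mem_univ i)).trans
        (e1 j (Finset.mem_univ j)).ge)

theorem sum_eq_one_of_closed {P : Matrix (Fin n) (Fin n) ℝ} (hP : IsSubstochastic P)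
    {T : Finset (Fin n)} {i : Fin n} (h1 : ∑ j, P i j = 1) (hT : ∀ j, 0 < P i j → j ∈ T) :
    ∑ j ∈ T, P i j = 1 := by
  rw [← h1]
  exact Finset.sum_subset (Finset.subset_univ T) fun j _ hj =>
    le_antisymm (not_lt.mp fun h => hj (hT j h)) (hP.1 i j)

/-! ### The equations in coordinates; solvability and comparison -/

theorem linearEq_iff {α μ : Fin n → ℝ} {P Q : Matrix (Fin n) (Fin n) ℝ} {S B : Finset (Fin n)}
    {x : Fin n → ℝ} : LinearEq α μ P Q S B x ↔
      ∀ j, x j = α j + ∑ i, ((if i ∈ S then x i else μ i) * P i j +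
        (if i ∈ B then x i - μ i else 0) * Q i j) := by
  unfold LinearEq
  rw [funext_iff]
  refine forall_congr' fun j => ?_
  simp only [Pi.add_apply, Matrix.vecMul, dotProduct, restrictRows_apply, Finset.mem_compl,
    Pi.sub_apply, add_assoc, ← Finset.sum_add_distrib]
  have : ∀ i, μ i * (if i ∉ S then P i j else 0) + (x i * (if i ∈ S then P i j else 0) +
      (x i - μ i) * (if i ∈ B then Q i j else 0)) =
      (if i ∈ S then x i else μ i) * P i j + (if i ∈ B then x i - μ i else 0) * Q i j := by
    intro i
    by_cases h1 : i ∈ S <;> by_cases h2 : i ∈ B <;> simp [h1, h2]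
  simp only [this]

theorem overflowEq_iff {α μ : Fin n → ℝ} {P Q : Matrix (Fin n) (Fin n) ℝ} {x : Fin n → ℝ} :
    OverflowEq α μ P Q x ↔
      ∀ j, x j = α j + ∑ i, (min (x i) (μ i) * P i j + max (x i - μ i) 0 * Q i j) := by
  unfold OverflowEq
  rw [funext_iff]
  refine forall_congr' fun j => ?_
  simp only [Pi.add_apply, Matrix.vecMul, dotProduct, Pi.sub_apply, Pi.inf_apply, Pi.sup_apply,
    Pi.zero_apply, add_assoc, ← Finset.sum_add_distrib]

theorem goodmanMasseyEq_iff {α μ : Fin n → ℝ} {P : Matrix (Fin n) (Fin n) ℝ} {x : Fin n → ℝ} :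
    GoodmanMasseyEq α μ P x ↔ ∀ j, x j = α j + ∑ i, min (x i) (μ i) * P i j := by
  unfold GoodmanMasseyEq
  rw [funext_iff]
  rfl

theorem mem_overloaded {μ x : Fin n → ℝ} {i : Fin n} : i ∈ overloaded μ x ↔ μ i ≤ x i := by
  simp [overloaded]

theorem mem_stableOutside {μ x : Fin n → ℝ} {U : Finset (Fin n)} {i : Fin n} :
    i ∈ stableOutside μ U x ↔ i ∉ U ∧ x i < μ i := by
  simp [stableOutside]

theorem linearEq_existsUnique {α μ : Fin n → ℝ} {P Q : Matrix (Fin n) (Fin n) ℝ}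
    {S U : Finset (Fin n)} (hP : ∀ i j, 0 ≤ P i j) (hQ : ∀ i j, 0 ≤ Q i j)
    (hM : SubinvariantTrivial (restrictRows P S + restrictRows Q U)) :
    ∃! x, LinearEq α μ P Q S U x := by
  have h := hM.existsUnique (restrictRows_add_nonneg hP hQ S U)
    (α + μ ᵥ* restrictRows P Sᶜ - μ ᵥ* restrictRows Q U)
  refine (existsUnique_congr fun x => ?_).mp h
  unfold LinearEq
  rw [funext_iff]
  refine forall_congr' fun j => ?_
  have e : ∑ i, x i * (restrictRows P S + restrictRows Q U) i j =
      (x ᵥ* restrictRows P S + x ᵥ* restrictRows Q U) j := by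
    rw [← Matrix.vecMul_add]; rfl
  rw [e, Matrix.sub_vecMul]
  simp only [Pi.add_apply, Pi.sub_apply]
  constructor <;> intro h <;> linarith

/-- Comparison of a subsolution and a supersolution of the linear equation. -/
theorem le_of_linear_sub_super {α μ : Fin n → ℝ} {P Q : Matrix (Fin n) (Fin n) ℝ}
    {S U : Finset (Fin n)} (hP : ∀ i j, 0 ≤ P i j) (hQ : ∀ i j, 0 ≤ Q i j)
    (hM : SubinvariantTrivial (restrictRows P S + restrictRows Q U)) {v x : Fin n → ℝ}
    (hv : ∀ j, v j ≤ α j + ∑ i, ((if i ∈ S then v i else μ i) * P i j +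
        (if i ∈ U then v i - μ i else 0) * Q i j))
    (hx : ∀ j, α j + ∑ i, ((if i ∈ S then x i else μ i) * P i j +
        (if i ∈ U then x i - μ i else 0) * Q i j) ≤ x j) (i : Fin n) : v i ≤ x i := by
  refine sub_nonpos.mp (hM.nonpos (d := fun i => v i - x i)
    (restrictRows_add_nonneg hP hQ S U) (fun j => ?_) i)
  have e : ∑ i, (v i - x i) * (restrictRows P S + restrictRows Q U) i j =
      ∑ i, ((if i ∈ S then v i else μ i) * P i j + (if i ∈ U then v i - μ i else 0) * Q i j) -
      ∑ i, ((if i ∈ S then x i else μ i) * P i j +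
        (if i ∈ U then x i - μ i else 0) * Q i j) := by
    rw [← Finset.sum_sub_distrib]
    refine Finset.sum_congr rfl fun i _ => ?_
    simp only [Matrix.add_apply, restrictRows_apply]
    split_ifs <;> ring
  rw [e]
  linarith [hv j, hx j]

theorem subinvariantTrivial_zero : SubinvariantTrivial (0 : Matrix (Fin n) (Fin n) ℝ) :=
  fun y hy h i => le_antisymm (by simpa using h i) (hy i)

/-- A mass balance argument: if `P_S` has no nonzero subinvariant vector and `x` solves
`x = α + μ P_{N \ S} + x P_S`, then the same holds for `P_{S'}` if `x < μ` on `S'`. -/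
theorem subinvariantTrivial_restrictRows_of_lt {α μ : Fin n → ℝ} {P : Matrix (Fin n) (Fin n) ℝ}
    (hα : ∀ i, 0 ≤ α i) (hμ : ∀ i, 0 < μ i) (hP : IsSubstochastic P) {S S' : Finset (Fin n)}
    (hS : SubinvariantTrivial (restrictRows P S)) {x : Fin n → ℝ}
    (hx : ∀ j, x j = α j + ∑ i, (if i ∈ S then x i else μ i) * P i j)
    (hS' : ∀ i ∈ S', x i < μ i) : SubinvariantTrivial (restrictRows P S') := by
  have hle : ∀ A : Finset (Fin n), ∀ i j, restrictRows P A i j ≤ P i j := fun A i j => by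
    have := hP.1 i j
    rw [restrictRows_apply]; split_ifs <;> linarith
  have hx0 : ∀ i, 0 ≤ x i := fun i => by
    have := hS.nonpos (d := fun i => - x i) (fun i j => by
      have := hP.1 i j
      rw [restrictRows_apply]; split_ifs <;> linarith) (fun j => by
      simp only [neg_mul, Finset.sum_neg_distrib]
      rw [hx j]
      have : ∑ i, x i * restrictRows P S i j ≤ ∑ i, (if i ∈ S then x i else μ i) * P i j :=
        Finset.sum_le_sum fun i _ => by
          have := mul_nonneg (hμ i).le (hP.1 i j)
          rw [restrictRows_apply]; split_ifs <;> linarith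
      linarith [hα j]) i
    linarith
  set w : Fin n → ℝ := fun i => if i ∈ S then x i else μ i with hw
  have hw0 : ∀ i, 0 ≤ w i := fun i => by
    have := hx0 i
    have := (hμ i).le
    simp only [hw]; split_ifs <;> assumption
  intro y hy hyP
  have hyP' : ∀ j, y j ≤ ∑ i, y i * P i j := fun j => (hyP j).trans
    (Finset.sum_le_sum fun i _ => mul_le_mul_of_nonneg_left (hle S' i j) (hy i))
  obtain ⟨hinv, hsupp⟩ := hP.support_of_subinvariant hy hyP'
  -- Both `P` and `P_{S'}` reproduce `y`, so a row outside `S'` carries no mass; yet a row in the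
  -- support has sum one.
  have hTS' : ∀ i, 0 < y i → i ∈ S' := by
    intro i hi
    by_contra hiS
    have h1 : ∀ j, y i * P i j = 0 := fun j => by
      have := (Finset.sum_eq_sum_iff_of_le fun i _ =>
        mul_le_mul_of_nonneg_left (hle S' i j) (hy i)).mp
          (le_antisymm (Finset.sum_le_sum fun i _ =>
            mul_le_mul_of_nonneg_left (hle S' i j) (hy i)) ((hinv j).ge.trans (hyP j)))
          i (Finset.mem_univ i)
      rw [← this, restrictRows_apply, if_neg hiS, mul_zero]
    have h2 : ∑ j, y i * P i j = 0 := Finset.sum_eq_zero fun j _ => h1 j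
    rw [← Finset.mul_sum, (hsupp i hi).1, mul_one] at h2
    exact hi.ne' h2
  set T : Finset (Fin n) := Finset.univ.filter fun i => 0 < y i with hT
  have hmT : ∀ i, i ∈ T ↔ 0 < y i := fun i => by simp [hT]
  -- All the outflow `w` of the closed set `T` returns to `T`. As `x ≤ w` on `T`, strictly off `S`,
  -- this forces `T ⊆ S`.
  have hbal : ∑ i ∈ T, w i ≤ ∑ j ∈ T, x j := by
    calc ∑ i ∈ T, w i = ∑ i ∈ T, w i * ∑ j ∈ T, P i j := Finset.sum_congr rfl fun i hi => by
          have := hsupp i ((hmT i).mp hi)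
          rw [sum_eq_one_of_closed hP this.1 fun j hj => (hmT j).mpr (this.2 j hj), mul_one]
      _ = ∑ j ∈ T, ∑ i ∈ T, w i * P i j := by
          simp only [Finset.mul_sum]
          exact Finset.sum_comm
      _ ≤ ∑ j ∈ T, x j := Finset.sum_le_sum fun j _ => by
          rw [hx j]
          have := Finset.sum_le_sum_of_subset_of_nonneg (Finset.subset_univ T)
            (f := fun i => w i * P i j) fun i _ _ => mul_nonneg (hw0 i) (hP.1 i j)
          linarith [hα j]
  have hxw : ∀ i ∈ T, x i ≤ w i := fun i hi => by
    have := hS' i (hTS' i ((hmT i).mp hi))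
    simp only [hw]; split_ifs <;> linarith
  have hTS : ∀ i ∈ T, i ∈ S := by
    intro i hi
    by_contra hiS
    have := Finset.sum_lt_sum hxw ⟨i, hi, by
      simp only [hw, if_neg hiS]
      exact hS' i (hTS' i ((hmT i).mp hi))⟩
    linarith
  refine hS y hy fun j => (hyP' j).trans (Finset.sum_le_sum fun i _ => ?_)
  rcases (hy i).eq_or_lt with h | h
  · simp [← h]
  · rw [restrictRows_apply, if_pos (hTS i ((hmT i).mpr h))]

/-! ### Reachability and non-isolation -/

theorem IsSubstochastic.pow_nonneg {P : Matrix (Fin n) (Fin n) ℝ} (hP : IsSubstochastic P)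
    (k : ℕ) (i j : Fin n) : 0 ≤ (P ^ k) i j := by
  induction k generalizing i with
  | zero => rw [pow_zero, Matrix.one_apply]; split_ifs <;> norm_num
  | succ k ih =>
    rw [pow_succ', Matrix.mul_apply]
    exact Finset.sum_nonneg fun l _ => mul_nonneg (hP.1 i l) (ih l)

theorem IsSubstochastic.exists_of_pow_succ_pos {P : Matrix (Fin n) (Fin n) ℝ}
    (hP : IsSubstochastic P) {k : ℕ} {i j : Fin n} (h : 0 < (P ^ (k + 1)) i j) :
    ∃ l, 0 < P i l ∧ 0 < (P ^ k) l j := by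
  rw [pow_succ', Matrix.mul_apply] at h
  obtain ⟨l, -, hl⟩ := Finset.exists_lt_of_sum_lt (f := fun _ => (0 : ℝ)) (by simpa using h)
  exact ⟨l, pos_of_mul_pos_left hl (hP.pow_nonneg k l j), pos_of_mul_pos_right hl (hP.1 i l)⟩

theorem IsSubstochastic.pow_add_pos {P : Matrix (Fin n) (Fin n) ℝ} (hP : IsSubstochastic P)
    {k l : ℕ} {i m j : Fin n} (h1 : 0 < (P ^ k) i m) (h2 : 0 < (P ^ l) m j) :
    0 < (P ^ (k + l)) i j := by
  rw [pow_add, Matrix.mul_apply]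
  exact (mul_pos h1 h2).trans_le (Finset.single_le_sum
    (f := fun m => (P ^ k) i m * (P ^ l) m j)
    (fun m _ => mul_nonneg (hP.pow_nonneg k i m) (hP.pow_nonneg l m j)) (Finset.mem_univ m))

/-- In a non-isolated network, a nonempty closed set of nodes with row sums one is reached by
some external inflow. -/
theorem NonIsolated.exists_inflow {α : Fin n → ℝ} {P : Matrix (Fin n) (Fin n) ℝ}
    (hP : IsSubstochastic P) (hN : NonIsolated α P) {T : Finset (Fin n)} (hT : T.Nonempty)
    (hone : ∀ i ∈ T, ∑ j, P i j = 1) (hclosed : ∀ i ∈ T, ∀ j, 0 < P i j → j ∈ T) :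
    ∃ i, 0 < α i ∧ ∃ j ∈ T, ∃ k : ℕ, 0 < (P ^ k) i j := by
  classical
  have hreach : ∀ k : ℕ, ∀ i ∈ T, ∀ j, 0 < (P ^ k) i j → j ∈ T := by
    intro k
    induction k with
    | zero =>
      intro i hi j hj
      rw [pow_zero, Matrix.one_apply] at hj
      split_ifs at hj with h
      · exact h ▸ hi
      · exact absurd hj (lt_irrefl 0)
    | succ k ih =>
      intro i hi j hj
      obtain ⟨l, h1, h2⟩ := hP.exists_of_pow_succ_pos hj
      exact ih l (hclosed i hi l h1) j h2
  let R : Fin n → Finset (Fin n) := fun i =>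
    Finset.univ.filter fun j => ∃ k : ℕ, 0 < (P ^ k) i j
  have hR : ∀ i j, j ∈ R i ↔ ∃ k : ℕ, 0 < (P ^ k) i j := fun i j => by simp [R]
  -- Minimality gives every node reachable from `a` the same reachable set, so `R a` is a closed
  -- communicating class inside `T`. It cannot be drained and hence can be filled.
  obtain ⟨a, haT, ha⟩ := Finset.exists_min_image T (fun i => (R i).card) hT
  have hself : ∀ i, i ∈ R i := fun i => (hR i i).mpr ⟨0, by simp⟩
  have hback : ∀ j ∈ R a, a ∈ R j := by
    intro j hj
    obtain ⟨k, hk⟩ := (hR a j).mp hj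
    have hsub : R j ⊆ R a := fun m hm => by
      obtain ⟨l, hl⟩ := (hR j m).mp hm
      exact (hR a m).mpr ⟨k + l, hP.pow_add_pos hk hl⟩
    rw [Finset.eq_of_subset_of_card_le hsub (ha j (hreach k a haT j hk))]
    exact hself a
  have hC : ∀ j, Communicate P a j ↔ j ∈ R a := by
    intro j
    constructor
    · rintro (h | ⟨h, -⟩)
      · exact h ▸ hself a
      · exact (hR a j).mpr h
    · intro h
      exact Or.inr ⟨(hR a j).mp h, (hR j a).mp (hback j h)⟩
  have hCT : ∀ j, Communicate P a j → j ∈ T := fun j hj => by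
    obtain ⟨k, hk⟩ := (hR a j).mp ((hC j).mp hj)
    exact hreach k a haT j hk
  have hdrain : ¬ CanBeDrained P {j | Communicate P a j} := by
    rintro (⟨i, hi, h⟩ | ⟨i, hi, j, hj, h⟩)
    · exact h.ne (hone i (hCT i hi))
    · obtain ⟨k, hk⟩ := (hR a i).mp ((hC i).mp hi)
      exact hj ((hC j).mpr ((hR a j).mpr ⟨k + 1, hP.pow_add_pos hk (by simpa using h)⟩))
  have hfill : CanBeFilled α P {j | Communicate P a j} := by
    by_contra h
    exact hN _ ⟨a, rfl⟩ ⟨h, hdrain⟩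
  rcases hfill with ⟨i, hi, h⟩ | ⟨i, h, j, hj, k, hk⟩
  · exact ⟨i, h, i, hCT i hi, 0, by simp⟩
  · exact ⟨i, h, j, hCT j hj, k, hk⟩

theorem IsSubstochastic.mem_of_pow_pos {P : Matrix (Fin n) (Fin n) ℝ} (hP : IsSubstochastic P)
    {H : Set (Fin n)} (hH : ∀ i j, j ∈ H → 0 < P i j → i ∈ H) (k : ℕ) {i j : Fin n} (hj : j ∈ H)
    (h : 0 < (P ^ k) i j) : i ∈ H := by
  induction k generalizing i with
  | zero =>
    rw [pow_zero, Matrix.one_apply] at h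
    split_ifs at h with e
    · exact e ▸ hj
    · exact absurd h (lt_irrefl 0)
  | succ k ih =>
    obtain ⟨l, h1, h2⟩ := hP.exists_of_pow_succ_pos h
    exact hH i l (ih h2) h1

/-! ### Lower bound and uniqueness for overflow solutions -/

/-- In a non-isolated network, every nonnegative solution of the Goodman--Massey equation is a
lower bound of every solution of the overflow equation. -/
theorem GoodmanMasseyEq.le_of_overflowEq {α μ : Fin n → ℝ} {P Q : Matrix (Fin n) (Fin n) ℝ}
    (hα : ∀ i, 0 ≤ α i) (hμ : ∀ i, 0 < μ i) (hP : IsSubstochastic P) (hQ : IsSubstochastic Q)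
    (hN : NonIsolated α P) {g x : Fin n → ℝ} (hg : GoodmanMasseyEq α μ P g)
    (hg0 : ∀ i, 0 ≤ g i) (hx : OverflowEq α μ P Q x) (i : Fin n) : g i ≤ x i := by
  rw [goodmanMasseyEq_iff] at hg
  rw [overflowEq_iff] at hx
  set d : Fin n → ℝ := fun i => max (g i - x i) 0 with hd
  have hd0 : ∀ i, 0 ≤ d i := fun i => le_max_right _ _
  -- The contribution of node `i` to `g j - x j`.
  set t : Fin n → Fin n → ℝ := fun i j =>
    (min (g i) (μ i) - min (x i) (μ i)) * P i j - max (x i - μ i) 0 * Q i j with ht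
  have hmin : ∀ i, min (g i) (μ i) - min (x i) (μ i) ≤ d i := fun i => by
    simp only [hd]
    rcases le_total (g i) (μ i) with h1 | h1 <;> rcases le_total (x i) (μ i) with h2 | h2 <;>
      simp only [h1, h2, min_eq_left, min_eq_right, le_max_iff] <;>
      first
        | (left; linarith)
        | (right; linarith)
  have htd : ∀ i j, t i j ≤ d i * P i j := fun i j => by
    have h1 := mul_le_mul_of_nonneg_right (hmin i) (hP.1 i j)
    have h2 := mul_nonneg (le_max_right (x i - μ i) 0) (hQ.1 i j)
    simp only [ht]
    linarith
  have hgx : ∀ j, g j - x j = ∑ i, t i j := fun j => by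
    rw [hg j, hx j, add_sub_add_left_eq_sub, ← Finset.sum_sub_distrib]
    exact Finset.sum_congr rfl fun i _ => by simp only [ht]; ring
  have hdP : ∀ j, d j ≤ ∑ i, d i * P i j := fun j => max_le
    ((hgx j).le.trans (Finset.sum_le_sum fun i _ => htd i j))
    (Finset.sum_nonneg fun i _ => mul_nonneg (hd0 i) (hP.1 i j))
  obtain ⟨hinv, hsupp⟩ := hP.support_of_subinvariant hd0 hdP
  set T : Finset (Fin n) := Finset.univ.filter fun i => 0 < d i with hT
  have hmT : ∀ i, i ∈ T ↔ 0 < d i := fun i => by simp [hT]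
  by_contra hcon
  have hTne : T.Nonempty := ⟨i, (hmT i).mpr (lt_max_of_lt_left (by linarith))⟩
  have hTt : ∀ j ∈ T, ∀ i, t i j = d i * P i j := by
    intro j hj i
    have hj' := (hmT j).mp hj
    have hdj : d j = g j - x j := by
      rcases lt_max_iff.mp hj' with h | h
      · exact max_eq_left h.le
      · exact absurd h (lt_irrefl 0)
    exact (Finset.sum_eq_sum_iff_of_le fun i _ => htd i j).mp
      (by rw [← hgx, ← hdj, ← hinv]) i (Finset.mem_univ i)
  -- Equality in `t i j ≤ d i * P i j` means that truncation at `μ` does not shrink the gap `g i - x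
  -- i > 0`, which is impossible when `g i > μ i`.
  have hTμ : ∀ i ∈ T, g i ≤ μ i := by
    intro i hi
    have hi' := (hmT i).mp hi
    obtain ⟨h1, h2⟩ := hsupp i hi'
    obtain ⟨j, -, hj⟩ := Finset.exists_lt_of_sum_lt (s := Finset.univ)
      (f := fun _ => (0 : ℝ)) (g := fun j => P i j) (by simp [h1])
    have h3 := hTt j ((hmT j).mpr (h2 j hj)) i
    have h4 := mul_nonneg (le_max_right (x i - μ i) 0) (hQ.1 i j)
    have h5 : d i ≤ min (g i) (μ i) - min (x i) (μ i) :=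
      le_of_mul_le_mul_right (by simp only [ht] at h3; linarith) hj
    by_contra hc
    rw [min_eq_right (not_le.mp hc).le] at h5
    rcases le_total (x i) (μ i) with h6 | h6
    · rw [min_eq_left h6] at h5
      have := le_max_left (g i - x i) 0
      simp only [hd] at h5
      linarith
    · rw [min_eq_right h6] at h5
      linarith
  have hm0 : ∀ i, 0 ≤ min (g i) (μ i) := fun i => le_min (hg0 i) (hμ i).le
  -- Untruncated on `T`, `g` circulates there without loss, so `T` receives nothing from outside.
  have hbal : ∑ j ∈ T, (α j + ∑ i ∈ Tᶜ, min (g i) (μ i) * P i j) = 0 := by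
    have h1 : ∑ j ∈ T, ∑ i ∈ T, min (g i) (μ i) * P i j = ∑ i ∈ T, g i := by
      rw [Finset.sum_comm]
      refine Finset.sum_congr rfl fun i hi => ?_
      have := hsupp i ((hmT i).mp hi)
      rw [← Finset.mul_sum, sum_eq_one_of_closed hP this.1 fun j hj => (hmT j).mpr (this.2 j hj),
        mul_one, min_eq_left (hTμ i hi)]
    have h2 : ∑ j ∈ T, g j = ∑ j ∈ T, (α j + ∑ i ∈ Tᶜ, min (g i) (μ i) * P i j) +
        ∑ j ∈ T, ∑ i ∈ T, min (g i) (μ i) * P i j := by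
      rw [← Finset.sum_add_distrib]
      refine Finset.sum_congr rfl fun j _ => ?_
      rw [add_assoc, add_comm (∑ i ∈ Tᶜ, _), Finset.sum_add_sum_compl, ← hg j]
    linarith
  have hsum0 : ∀ j, 0 ≤ ∑ i ∈ Tᶜ, min (g i) (μ i) * P i j := fun j =>
    Finset.sum_nonneg fun i _ => mul_nonneg (hm0 i) (hP.1 i j)
  have hbal' := (Finset.sum_eq_zero_iff_of_nonneg fun j _ => add_nonneg (hα j) (hsum0 j)).mp hbal
  have hzero : ∀ {i j}, min (g i) (μ i) * P i j = 0 → 0 < P i j → g i = 0 := by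
    intro i j h hj
    rcases mul_eq_zero.mp h with h | h
    · rcases min_choice (g i) (μ i) with e | e
      · rw [← e, h]
      · exact absurd (e ▸ h) (hμ i).ne'
    · exact absurd h hj.ne'
  have hGz : ∀ j, g j = 0 → α j = 0 ∧ ∀ i, 0 < P i j → g i = 0 := by
    intro j hj
    have h0 : ∀ i ∈ Finset.univ, 0 ≤ min (g i) (μ i) * P i j := fun i _ =>
      mul_nonneg (hm0 i) (hP.1 i j)
    have h1 := Finset.sum_nonneg h0
    have h2 := hg j
    have h3 := hα j
    refine ⟨by linarith, fun i hi => hzero ?_ hi⟩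
    exact (Finset.sum_eq_zero_iff_of_nonneg h0).mp (by linarith) i (Finset.mem_univ i)
  have hTz : ∀ j ∈ T, α j = 0 ∧ ∀ i, 0 < P i j → i ∈ T ∨ g i = 0 := by
    intro j hj
    have h1 := hbal' j hj
    have h2 := hsum0 j
    have h3 := hα j
    refine ⟨by linarith, fun i hi => or_iff_not_imp_left.mpr fun hiT => hzero ?_ hi⟩
    exact (Finset.sum_eq_zero_iff_of_nonneg fun i _ => mul_nonneg (hm0 i) (hP.1 i j)).mp
      (by linarith : ∑ i ∈ Tᶜ, min (g i) (μ i) * P i j = 0) i (Finset.mem_compl.mpr hiT)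
  obtain ⟨a, ha, j, hj, k, hk⟩ := hN.exists_inflow hP hTne
    (fun i hi => (hsupp i ((hmT i).mp hi)).1)
    (fun i hi j hj => (hmT j).mpr ((hsupp i ((hmT i).mp hi)).2 j hj))
  -- This set is closed under predecessors and has no external inflow, which contradicts
  -- non-isolation.
  have haH : a ∈ {i | i ∈ T ∨ g i = 0} := by
    refine hP.mem_of_pow_pos ?_ k (Or.inl hj) hk
    rintro i j (h | h) hij
    · exact (hTz j h).2 i hij
    · exact Or.inr ((hGz j h).2 i hij)
  rcases haH with h | h
  · exact ha.ne' (hTz a h).1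
  · exact ha.ne' (hGz a h).1

theorem overflowEq_unique {α μ : Fin n → ℝ} {P Q : Matrix (Fin n) (Fin n) ℝ}
    (hP : ∀ i j, 0 ≤ P i j) (hQ : ∀ i j, 0 ≤ Q i j) {B : Finset (Fin n)}
    (h : ∀ A : Finset (Fin n), A ⊆ Bᶜ →
      SubinvariantTrivial (restrictRows P A + restrictRows Q Aᶜ)ᵀ)
    {x z : Fin n → ℝ} (hx : OverflowEq α μ P Q x) (hz : OverflowEq α μ P Q z)
    (hxB : ∀ i ∈ B, μ i ≤ x i) (hzB : ∀ i ∈ B, μ i ≤ z i) : x = z := by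
  rw [overflowEq_iff] at hx hz
  set a : Fin n → ℝ := fun i => |min (x i) (μ i) - min (z i) (μ i)| with ha
  set b : Fin n → ℝ := fun i => |max (x i - μ i) 0 - max (z i - μ i) 0| with hb
  -- `min (·, μ)` and `max (· - μ, 0)` are both monotone and sum to the identity, so their
  -- increments have the same sign.
  have hab : ∀ i, a i + b i = |x i - z i| := by
    intro i
    simp only [ha, hb]
    rcases le_total (x i) (μ i) with h1 | h1 <;> rcases le_total (z i) (μ i) with h2 | h2 <;>
      simp only [h1, h2, min_eq_left, min_eq_right, sub_nonpos.mpr, sub_nonneg.mpr, max_eq_left,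
        max_eq_right, sub_self, abs_zero, add_zero, zero_add, sub_sub_sub_cancel_right, sub_zero,
        zero_sub, abs_neg]
    · rw [abs_of_nonpos (sub_nonpos.mpr h1), abs_of_nonneg (sub_nonneg.mpr h2),
        abs_of_nonpos (sub_nonpos.mpr (h1.trans h2))]
      ring
    · rw [abs_of_nonneg (sub_nonneg.mpr h1), abs_of_nonneg (sub_nonneg.mpr h2),
        abs_of_nonneg (sub_nonneg.mpr (h2.trans h1))]
      ring
  have ha0 : ∀ i, 0 ≤ a i := fun i => abs_nonneg _
  have hb0 : ∀ i, 0 ≤ b i := fun i => abs_nonneg _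
  have hθ : ∀ i, a i / |x i - z i| * |x i - z i| = a i := fun i =>
    div_mul_cancel_of_imp fun h0 => by linarith [hab i, ha0 i, hb0 i]
  -- The weight is the share of the difference that is routed through `P`. It is zero on `B`, and
  -- also where `x i = z i`, by `0 / 0 = 0`.
  have key := subinvariantTrivial_mixture hP hQ h (θ := fun i => a i / |x i - z i|)
    (fun i => div_nonneg (ha0 i) (abs_nonneg _))
    (fun i => div_le_one_of_le₀ (by linarith [hab i, hb0 i]) (abs_nonneg _))
    (fun i hi => by simp [ha, min_eq_right (hxB i hi), min_eq_right (hzB i hi)])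
    (fun i => |x i - z i|) (fun i => abs_nonneg _) (fun j => by
      have e1 : x j - z j = ∑ i, ((min (x i) (μ i) - min (z i) (μ i)) * P i j +
          (max (x i - μ i) 0 - max (z i - μ i) 0) * Q i j) := by
        rw [hx j, hz j, add_sub_add_left_eq_sub, ← Finset.sum_sub_distrib]
        exact Finset.sum_congr rfl fun i _ => by ring
      rw [e1]
      refine (Finset.abs_sum_le_sum_abs _ _).trans (Finset.sum_le_sum fun i _ => ?_)
      refine (abs_add_le _ _).trans (le_of_eq ?_)
      rw [abs_mul, abs_mul, abs_of_nonneg (hP i j), abs_of_nonneg (hQ i j), Matrix.of_apply]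
      change a i * P i j + b i * Q i j = _
      have e2 : b i = (1 - a i / |x i - z i|) * |x i - z i| := by
        rw [sub_mul, hθ, one_mul, ← hab i]; ring
      rw [e2]
      nth_rewrite 1 [← hθ i]
      ring)
  funext i
  exact sub_eq_zero.mp (abs_eq_zero.mp (key i))

/-! ### Invariants of the algorithm -/

/-- The properties of a pair `(U, S)` that the overflow algorithm preserves. -/
structure Invariant (α μ : Fin n → ℝ) (P Q : Matrix (Fin n) (Fin n) ℝ) (U S : Finset (Fin n)) :
    Prop where
  subset_compl : S ⊆ Uᶜ
  trivial : SubinvariantTrivial (restrictRows P S + restrictRows Q U)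
  lt_of_mem : ∀ x, LinearEq α μ P Q S U x → ∀ i ∈ S, x i < μ i
  -- The witness is zero at the start, then the final vector of the previous outer pass.
  exists_subsolution : ∃ v : Fin n → ℝ, (∀ i, 0 ≤ v i) ∧ overloaded μ v = U ∧
    ∀ j, v j ≤ α j + ∑ i, (min (v i) (μ i) * P i j + max (v i - μ i) 0 * Q i j)
  exists_goodmanMassey : U = ∅ ∨
    ∃ g, (∀ i, 0 ≤ g i) ∧ GoodmanMasseyEq α μ P g ∧ overloaded μ g ⊆ U

theorem restrictRows_empty (Q : Matrix (Fin n) (Fin n) ℝ) : restrictRows Q ∅ = 0 := by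
  ext i j
  simp [restrictRows_apply]

theorem Invariant.empty {α μ : Fin n → ℝ} {P Q : Matrix (Fin n) (Fin n) ℝ}
    (hα : ∀ i, 0 ≤ α i) (hμ : ∀ i, 0 < μ i) : Invariant α μ P Q ∅ ∅ where
  subset_compl := Finset.empty_subset _
  trivial := by
    rw [restrictRows_empty, restrictRows_empty, add_zero]
    exact subinvariantTrivial_zero
  lt_of_mem := fun x _ i hi => absurd hi (Finset.notMem_empty i)
  exists_subsolution := by
    refine ⟨0, fun i => le_rfl, ?_, fun j => ?_⟩
    · ext i
      simp [mem_overloaded, hμ i]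
    · refine add_nonneg (hα j) (Finset.sum_nonneg fun i _ => ?_)
      simp [(hμ i).le]
  exists_goodmanMassey := Or.inl rfl

section

variable {α μ : Fin n → ℝ} {P Q : Matrix (Fin n) (Fin n) ℝ} {U S : Finset (Fin n)}
  {x : Fin n → ℝ}

/-- The solution of the linear equation is nonnegative and at least `μ` on `U`. -/
theorem Invariant.nonneg_and_le (h : Invariant α μ P Q U S) (hP : ∀ i j, 0 ≤ P i j)
    (hQ : ∀ i j, 0 ≤ Q i j) (hx : LinearEq α μ P Q S U x) :
    (∀ i, 0 ≤ x i) ∧ ∀ i ∈ U, μ i ≤ x i := by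
  obtain ⟨v, hv0, hvU, hv⟩ := h.exists_subsolution
  -- Because `U` is exactly the overloaded set of `v`, the overflow terms agree, while `min (v, μ)`
  -- is below either choice made by `S`.
  have hvx : ∀ i, v i ≤ x i := by
    refine le_of_linear_sub_super hP hQ h.trivial (fun j => (hv j).trans ?_)
      fun j => ((linearEq_iff.mp hx) j).ge
    gcongr with i _ i
    · exact hP _ _
    · split_ifs
      · exact min_le_left _ _
      · exact min_le_right _ _
    · exact hQ _ _
    · simp only [← hvU, mem_overloaded]
      split_ifs with hi
      · exact (max_eq_left (sub_nonneg.mpr hi)).le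
      · exact (max_eq_right (sub_nonpos.mpr (not_le.mp hi).le)).le
  refine ⟨fun i => (hv0 i).trans (hvx i), fun i hi => ?_⟩
  rw [← hvU, mem_overloaded] at hi
  exact hi.trans (hvx i)

theorem Invariant.subset_stableOutside (h : Invariant α μ P Q U S)
    (hx : LinearEq α μ P Q S U x) : S ⊆ stableOutside μ U x := fun i hi =>
  mem_stableOutside.mpr ⟨Finset.mem_compl.mp (h.subset_compl hi), h.lt_of_mem x hx i hi⟩

/-- The old solution is a supersolution of the new equation, since it is below `μ` on the nodes
added to `S`; hence the new solution stays below `μ` there. The spectral part uses mass balance when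
`U = ∅`, and otherwise `P_{S'} + Q_U ≤ P_{S'} + Q_{N \ S'}`. -/
theorem Invariant.inner (h : Invariant α μ P Q U S) (hα : ∀ i, 0 ≤ α i) (hμ : ∀ i, 0 < μ i)
    (hP : IsSubstochastic P) (hQ : IsSubstochastic Q)
    (hcond : ∀ g, GoodmanMasseyEq α μ P g → ∀ A : Finset (Fin n), A ⊆ (overloaded μ g)ᶜ →
      SubinvariantTrivial (restrictRows P A + restrictRows Q Aᶜ))
    (hx : LinearEq α μ P Q S U x) : Invariant α μ P Q U (stableOutside μ U x) := by
  have hsub := h.subset_stableOutside hx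
  have hlt : ∀ i ∈ stableOutside μ U x, x i < μ i := fun i hi => (mem_stableOutside.mp hi).2
  have htriv : SubinvariantTrivial (restrictRows P (stableOutside μ U x) + restrictRows Q U) := by
    rcases h.exists_goodmanMassey with rfl | ⟨g, -, hg, hgU⟩
    · have h1 := h.trivial
      rw [restrictRows_empty, add_zero] at h1 ⊢
      exact subinvariantTrivial_restrictRows_of_lt hα hμ hP h1
        (by simpa using linearEq_iff.mp hx) hlt
    · refine (hcond g hg (stableOutside μ U x) fun i hi => Finset.mem_compl.mpr fun hi' =>
        (mem_stableOutside.mp hi).1 (hgU hi')).mono fun i j => ?_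
      simp only [Matrix.add_apply, restrictRows_apply]
      gcongr
      have := hQ.1 i j
      have hi : i ∈ U → i ∈ (stableOutside μ U x)ᶜ := fun hi =>
        Finset.mem_compl.mpr fun hi' => (mem_stableOutside.mp hi').1 hi
      by_cases h1 : i ∈ U
      · rw [if_pos h1, if_pos (hi h1)]
      · rw [if_neg h1]
        split_ifs <;> simp [this]
  refine ⟨fun i hi => Finset.mem_compl.mpr (mem_stableOutside.mp hi).1, htriv,
    fun z hz i hi => ?_, h.exists_subsolution, h.exists_goodmanMassey⟩
  refine lt_of_le_of_lt ?_ (hlt i hi)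
  refine le_of_linear_sub_super hP.1 hQ.1 htriv (fun j => ((linearEq_iff.mp hz) j).le)
    (fun j => ?_) i
  rw [linearEq_iff.mp hx j]
  gcongr with i _ i
  · exact hP.1 _ _
  · by_cases h1 : i ∈ S
    · rw [if_pos h1, if_pos (hsub h1)]
    · rw [if_neg h1]
      split_ifs with h2
      · exact (hlt i h2).le
      · exact le_rfl

/-- When the inner loop ends, the solution of the linear equation solves a traffic equation in
which the overflows of the nodes outside `U` are lost. -/
theorem Invariant.eq_of_stable (h : Invariant α μ P Q U S) (hP : ∀ i j, 0 ≤ P i j)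
    (hQ : ∀ i j, 0 ≤ Q i j) (hx : LinearEq α μ P Q S U x) (hS : stableOutside μ U x = S) (j) :
    x j = α j + ∑ i, (min (x i) (μ i) * P i j + (if i ∈ U then x i - μ i else 0) * Q i j) := by
  rw [linearEq_iff.mp hx j]
  congr 2
  funext i
  congr 2
  have hU := (h.nonneg_and_le hP hQ hx).2 i
  simp only [← hS, mem_stableOutside]
  split_ifs with h1
  · exact (min_eq_left h1.2.le).symm
  · refine (min_eq_right ?_).symm
    by_cases h2 : i ∈ U
    · exact hU h2
    · exact not_lt.mp fun h3 => h1 ⟨h2, h3⟩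

theorem Invariant.goodmanMassey_of_stable (h : Invariant α μ P Q U S) (hP : ∀ i j, 0 ≤ P i j)
    (hQ : ∀ i j, 0 ≤ Q i j) (hx : LinearEq α μ P Q S U x) (hS : stableOutside μ U x = S) :
    ∃ g, (∀ i, 0 ≤ g i) ∧ GoodmanMasseyEq α μ P g ∧ overloaded μ g ⊆ overloaded μ x := by
  obtain ⟨h0, hle⟩ := h.nonneg_and_le hP hQ hx
  rcases h.exists_goodmanMassey with rfl | ⟨g, hg0, hg, hgU⟩
  · refine ⟨x, h0, goodmanMasseyEq_iff.mpr fun j => ?_, subset_rfl⟩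
    simpa using h.eq_of_stable hP hQ hx hS j
  · exact ⟨g, hg0, hg, hgU.trans fun i hi => mem_overloaded.mpr (hle i hi)⟩

/-- The vector `x` becomes the new subsolution, as enlarging `U` only adds overflow. The case `A =
∅` of the condition controls `Q` and so `Q_U`. -/
theorem Invariant.outer (h : Invariant α μ P Q U S) (hP : ∀ i j, 0 ≤ P i j)
    (hQ : ∀ i j, 0 ≤ Q i j)
    (hcond : ∀ g, GoodmanMasseyEq α μ P g → ∀ A : Finset (Fin n), A ⊆ (overloaded μ g)ᶜ →
      SubinvariantTrivial (restrictRows P A + restrictRows Q Aᶜ))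
    (hx : LinearEq α μ P Q S U x) (hS : stableOutside μ U x = S) :
    Invariant α μ P Q (overloaded μ x) ∅ := by
  obtain ⟨h0, hle⟩ := h.nonneg_and_le hP hQ hx
  obtain ⟨g, hg0, hg, hgx⟩ := h.goodmanMassey_of_stable hP hQ hx hS
  refine ⟨Finset.empty_subset _, ?_, fun z _ i hi => absurd hi (Finset.notMem_empty i),
    ⟨x, h0, rfl, fun j => ?_⟩, Or.inr ⟨g, hg0, hg, hgx⟩⟩
  · refine (hcond g hg ∅ (Finset.empty_subset _)).mono fun i j => ?_
    have := hQ i j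
    simp only [Matrix.add_apply, restrictRows_apply, Finset.compl_empty, Finset.mem_univ, if_true]
    gcongr
    split_ifs <;> linarith
  · refine (h.eq_of_stable hP hQ hx hS j).le.trans ?_
    gcongr with i
    · exact hQ _ _
    · split_ifs
      · exact le_max_left _ _
      · exact le_max_right _ _

theorem Invariant.overflowEq_of_halt (h : Invariant α μ P Q U S) (hP : ∀ i j, 0 ≤ P i j)
    (hQ : ∀ i j, 0 ≤ Q i j) (hx : LinearEq α μ P Q S U x) (hS : stableOutside μ U x = S)
    (hU : overloaded μ x = U) : OverflowEq α μ P Q x := by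
  refine overflowEq_iff.mpr fun j => (h.eq_of_stable hP hQ hx hS j).trans ?_
  congr 2
  funext i
  congr 2
  simp only [← hU, mem_overloaded]
  split_ifs with hi
  · exact (max_eq_left (sub_nonneg.mpr hi)).symm
  · exact (max_eq_right (sub_nonpos.mpr (not_le.mp hi).le)).symm

theorem Invariant.card_outer (h : Invariant α μ P Q U S) (hP : ∀ i j, 0 ≤ P i j)
    (hQ : ∀ i j, 0 ≤ Q i j) (hx : LinearEq α μ P Q S U x) (hU : overloaded μ x ≠ U) :
    U.card < (overloaded μ x).card ∧ S.card + (overloaded μ x).card ≤ n := by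
  obtain ⟨-, hle⟩ := h.nonneg_and_le hP hQ hx
  refine ⟨Finset.card_lt_card ((Finset.ssubset_iff_subset_ne).mpr
    ⟨fun i hi => mem_overloaded.mpr (hle i hi), hU.symm⟩), ?_⟩
  have hd : Disjoint S (overloaded μ x) := Finset.disjoint_left.mpr fun i hi hi' =>
    absurd (h.lt_of_mem x hx i hi) (not_lt.mpr (mem_overloaded.mp hi'))
  rw [← Finset.card_union_of_disjoint hd]
  simpa using Finset.card_le_univ (S ∪ overloaded μ x)

theorem Invariant.card_add_le (h : Invariant α μ P Q U S) : S.card + U.card ≤ n := by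
  have hd : Disjoint S U := Finset.disjoint_left.mpr fun i hi =>
    Finset.mem_compl.mp (h.subset_compl hi)
  rw [← Finset.card_union_of_disjoint hd]
  simpa using Finset.card_le_univ (S ∪ U)

end

/-! ### Iteration count and executions -/

theorem sum_range_sub_mono (n : ℕ) {u v : ℕ} (h : u ≤ v) :
    ∑ j ∈ Finset.range u, (n - j) ≤ ∑ j ∈ Finset.range v, (n - j) :=
  Finset.sum_le_sum_of_subset (Finset.range_subset_range.mpr h)

theorem sum_range_succ_sub (n : ℕ) : ∑ j ∈ Finset.range (n + 1), (n - j) = n * (n + 1) / 2 := by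
  have := Finset.sum_range_reflect (fun j => j) (n + 1)
  simp only [Nat.add_sub_cancel] at this
  rw [this, Finset.sum_range_id, Nat.add_sub_cancel, mul_comm]

/-- What holds for a configuration of the algorithm that is reached after `k` iterations. -/
def Config.Good (α μ : Fin n → ℝ) (P Q : Matrix (Fin n) (Fin n) ℝ) (k : ℕ) : Config n → Prop
  | .running U S => Invariant α μ P Q U S ∧
      k ≤ ∑ j ∈ Finset.range U.card, (n - j) + S.card
  | .returned x => OverflowEq α μ P Q x ∧ (∀ i, 0 ≤ x i) ∧
      (∃ g, (∀ i, 0 ≤ g i) ∧ GoodmanMasseyEq α μ P g) ∧ k ≤ 1 + n * (n + 1) / 2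

/-- Each inner step enlarges `S`. At an outer step `|S| + |U'| ≤ n` and `|U| < |U'|`, so `|S| + 1 ≤
n - |U|`: the pass fits into the summand `j = |U|`. The last pass may have `|S| = n - |U|`, which
accounts for the extra `1`. -/
theorem RunsTo.good {α μ : Fin n → ℝ} {P Q : Matrix (Fin n) (Fin n) ℝ} (hα : ∀ i, 0 ≤ α i)
    (hμ : ∀ i, 0 < μ i) (hP : IsSubstochastic P) (hQ : IsSubstochastic Q)
    (hcond : ∀ g, GoodmanMasseyEq α μ P g → ∀ A : Finset (Fin n), A ⊆ (overloaded μ g)ᶜ →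
      SubinvariantTrivial (restrictRows P A + restrictRows Q Aᶜ))
    {k : ℕ} {c : Config n} (h : RunsTo α μ P Q k c) : c.Good α μ P Q k := by
  induction h with
  | start => exact ⟨Invariant.empty hα hμ, Nat.zero_le _⟩
  | step k c c' _ hs ih =>
    cases hs with
    | inner U S x hx hS =>
      obtain ⟨hI, hk⟩ := ih
      refine ⟨hI.inner hα hμ hP hQ hcond hx, ?_⟩
      have := Finset.card_lt_card (Finset.ssubset_iff_subset_ne.mpr
        ⟨hI.subset_stableOutside hx, hS.symm⟩)
      omega
    | outer U S x hx hS hU =>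
      obtain ⟨hI, hk⟩ := ih
      refine ⟨hI.outer hP.1 hQ.1 hcond hx hS, ?_⟩
      obtain ⟨h1, h2⟩ := hI.card_outer hP.1 hQ.1 hx hU
      have h3 := sum_range_sub_mono n (Nat.succ_le_of_lt h1)
      rw [Nat.succ_eq_add_one, Finset.sum_range_succ] at h3
      omega
    | halt U S x hx hS hU =>
      obtain ⟨hI, hk⟩ := ih
      obtain ⟨g, hg0, hg, -⟩ := hI.goodmanMassey_of_stable hP.1 hQ.1 hx hS
      refine ⟨hI.overflowEq_of_halt hP.1 hQ.1 hx hS hU, (hI.nonneg_and_le hP.1 hQ.1 hx).1,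
        ⟨g, hg0, hg⟩, ?_⟩
      have h2 := hI.card_add_le
      have h3 := sum_range_sub_mono n (Nat.succ_le_succ (by omega : U.card ≤ n))
      rw [Nat.succ_eq_add_one, Nat.succ_eq_add_one, sum_range_succ_sub,
        Finset.sum_range_succ] at h3
      omega

theorem RunsTo.exists_add {α μ : Fin n → ℝ} {P Q : Matrix (Fin n) (Fin n) ℝ} {k m : ℕ}
    {c : Config n} (h : RunsTo α μ P Q (k + m) c) : ∃ c', RunsTo α μ P Q k c' := by
  induction m generalizing c with
  | zero => exact ⟨c, h⟩
  | succ m ih =>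
    cases h with
    | step _ c' _ hc _ => exact ih hc

/-- A longer run would pass through time `k`, but a returned configuration has no successor. -/
theorem RunsTo.le_of_unique_returned {α μ : Fin n → ℝ} {P Q : Matrix (Fin n) (Fin n) ℝ}
    {k m : ℕ} {x : Fin n → ℝ} (hx : ∀ c, RunsTo α μ P Q k c → c = Config.returned x)
    {c : Config n} (h : RunsTo α μ P Q m c) : m ≤ k := by
  by_contra hlt
  obtain ⟨l, rfl⟩ := Nat.exists_eq_add_of_lt (not_le.mp hlt)
  rw [add_right_comm] at h
  obtain ⟨c', h'⟩ := h.exists_add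
  cases h' with
  | step _ c'' _ hc hs =>
    rw [hx c'' hc] at hs
    cases hs

theorem Step.deterministic {α μ : Fin n → ℝ} {P Q : Matrix (Fin n) (Fin n) ℝ}
    {U S : Finset (Fin n)} (hu : ∃! x, LinearEq α μ P Q S U x) {c c' : Config n}
    (h : Step α μ P Q (.running U S) c) (h' : Step α μ P Q (.running U S) c') : c = c' := by
  cases h with
  | inner _ _ x hx hS =>
    cases h' with
    | inner _ _ z hz _ => rw [hu.unique hz hx]
    | outer _ _ z hz hS' _ => exact absurd (hu.unique hz hx ▸ hS') hS
    | halt _ _ z hz hS' _ => exact absurd (hu.unique hz hx ▸ hS') hS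
  | outer _ _ x hx hS hU =>
    cases h' with
    | inner _ _ z hz hS' => exact absurd (hu.unique hx hz ▸ hS) hS'
    | outer _ _ z hz _ _ => rw [hu.unique hz hx]
    | halt _ _ z hz _ hU' => exact absurd (hu.unique hz hx ▸ hU') hU
  | halt _ _ x hx hS hU =>
    cases h' with
    | inner _ _ z hz hS' => exact absurd (hu.unique hx hz ▸ hS) hS'
    | outer _ _ z hz _ hU' => exact absurd (hu.unique hx hz ▸ hU) hU'
    | halt _ _ z hz _ _ => rw [hu.unique hz hx]

theorem RunsTo.deterministic {α μ : Fin n → ℝ} {P Q : Matrix (Fin n) (Fin n) ℝ}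
    (hu : ∀ (k : ℕ) (U S : Finset (Fin n)), RunsTo α μ P Q k (.running U S) →
      ∃! x, LinearEq α μ P Q S U x) {k : ℕ} {c c' : Config n}
    (h : RunsTo α μ P Q k c) (h' : RunsTo α μ P Q k c') : c = c' := by
  induction k generalizing c c' with
  | zero =>
    cases h
    cases h'
    rfl
  | succ k ih =>
    cases h with
    | step _ d _ hd hs =>
      cases h' with
      | step _ d' _ hd' hs' =>
        obtain rfl := ih hd hd'
        cases d with
        | running U S => exact Step.deterministic (hu k U S hd) hs hs'
        | returned x => cases hs

theorem Step.exists_of_linearEq {α μ : Fin n → ℝ} {P Q : Matrix (Fin n) (Fin n) ℝ}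
    {U S : Finset (Fin n)} {x : Fin n → ℝ} (hx : LinearEq α μ P Q S U x) :
    ∃ c, Step α μ P Q (.running U S) c := by
  by_cases hS : stableOutside μ U x = S
  · by_cases hU : overloaded μ x = U
    · exact ⟨_, .halt U S x hx hS hU⟩
    · exact ⟨_, .outer U S x hx hS hU⟩
  · exact ⟨_, .inner U S x hx hS⟩

/-- If every linear equation met is solvable and the running configurations occur at bounded times
only, then the algorithm returns some vector. -/
theorem exists_runsTo_returned {α μ : Fin n → ℝ} {P Q : Matrix (Fin n) (Fin n) ℝ}
    (hu : ∀ (k : ℕ) (U S : Finset (Fin n)), RunsTo α μ P Q k (.running U S) →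
      ∃ x, LinearEq α μ P Q S U x) {b : ℕ}
    (hb : ∀ (k : ℕ) (U S : Finset (Fin n)), RunsTo α μ P Q k (.running U S) → k ≤ b) :
    ∃ K x, RunsTo α μ P Q K (.returned x) := by
  by_contra hcon
  push Not at hcon
  have hall : ∀ k, ∃ U S, RunsTo α μ P Q k (.running U S) := by
    intro k
    induction k with
    | zero => exact ⟨_, _, .start⟩
    | succ k ih =>
      obtain ⟨U, S, h⟩ := ih
      obtain ⟨x, hx⟩ := hu k U S h
      obtain ⟨c, hc⟩ := Step.exists_of_linearEq hx
      cases c with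
      | running U' S' => exact ⟨U', S', .step k _ _ h hc⟩
      | returned y => exact absurd (.step k _ _ h hc) (hcon (k + 1) y)
  obtain ⟨U, S, h⟩ := hall (b + 1)
  exact absurd (hb _ U S h) (by omega)

end OverflowNetwork

theorem theorem2 (n : ℕ) (α μ : Fin n → ℝ) (P Q : Matrix (Fin n) (Fin n) ℝ)
    (hα : ∀ i, 0 ≤ α i) (hμ : ∀ i, 0 < μ i)
    (hP : OverflowNetwork.IsSubstochastic P) (hQ : OverflowNetwork.IsSubstochastic Q)
    (hcond : OverflowNetwork.OverflowCondition α μ P Q) :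
    ∃ lam : Fin n → ℝ,
      -- `lam` is a nonnegative solution of the overflow traffic equation, and the only solution
      (∀ i, 0 ≤ lam i) ∧
      OverflowNetwork.OverflowEq α μ P Q lam ∧
      (∀ x, OverflowNetwork.OverflowEq α μ P Q x → x = lam) ∧
      -- every iteration solves a linear equation that has exactly one solution
      (∀ (k : ℕ) (U S : Finset (Fin n)),
        OverflowNetwork.RunsTo α μ P Q k (OverflowNetwork.Config.running U S) →
          ∃! x, OverflowNetwork.LinearEq α μ P Q S U x) ∧
      -- the algorithm returns `lam` after `K` iterations, and nothing else
      ∃ K : ℕ,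
        OverflowNetwork.RunsTo α μ P Q K (OverflowNetwork.Config.returned lam) ∧
        (∀ (k : ℕ) (x : Fin n → ℝ),
          OverflowNetwork.RunsTo α μ P Q k (OverflowNetwork.Config.returned x) →
            k = K ∧ x = lam) ∧
        K ≤ 1 + n * (n + 1) / 2 ∧
        (2 ≤ n → K ≤ n ^ 2) := by
  have hright : ∀ g, OverflowNetwork.GoodmanMasseyEq α μ P g → ∀ A : Finset (Fin n),
      A ⊆ (OverflowNetwork.overloaded μ g)ᶜ → OverflowNetwork.SubinvariantTrivial
        (OverflowNetwork.restrictRows P A + OverflowNetwork.restrictRows Q Aᶜ)ᵀ :=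
    fun g hg A hA => OverflowNetwork.subinvariantTrivial_transpose_of_specRad_lt_one
      (OverflowNetwork.restrictRows_add_nonneg hP.1 hQ.1 A Aᶜ) (hcond.2 g hg A hA)
  have hleft : ∀ g, OverflowNetwork.GoodmanMasseyEq α μ P g → ∀ A : Finset (Fin n),
      A ⊆ (OverflowNetwork.overloaded μ g)ᶜ → OverflowNetwork.SubinvariantTrivial
        (OverflowNetwork.restrictRows P A + OverflowNetwork.restrictRows Q Aᶜ) :=
    fun g hg A hA => (hright g hg A hA).of_transpose
      (OverflowNetwork.restrictRows_add_nonneg hP.1 hQ.1 A Aᶜ)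
  have hu : ∀ (k : ℕ) (U S : Finset (Fin n)),
      OverflowNetwork.RunsTo α μ P Q k (OverflowNetwork.Config.running U S) →
        ∃! x, OverflowNetwork.LinearEq α μ P Q S U x := fun k U S h =>
    OverflowNetwork.linearEq_existsUnique hP.1 hQ.1 (h.good hα hμ hP hQ hleft).1.trivial
  obtain ⟨K, lam, hK⟩ := OverflowNetwork.exists_runsTo_returned
    (fun k U S h => (hu k U S h).exists)
    (b := ∑ j ∈ Finset.range n, (n - j) + n) fun k U S h => by
      obtain ⟨hI, hk⟩ := h.good hα hμ hP hQ hleft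
      have h1 := hI.card_add_le
      have h2 := OverflowNetwork.sum_range_sub_mono n (by omega : U.card ≤ n)
      omega
  obtain ⟨hsol, hnonneg, ⟨g, hg0, hg⟩, hbound⟩ := hK.good hα hμ hP hQ hleft
  have hge : ∀ x, OverflowNetwork.OverflowEq α μ P Q x →
      ∀ i ∈ OverflowNetwork.overloaded μ g, μ i ≤ x i := fun x hx i hi =>
    (OverflowNetwork.mem_overloaded.mp hi).trans
      (hg.le_of_overflowEq hα hμ hP hQ hcond.1 hg0 hx i)
  refine ⟨lam, hnonneg, hsol, fun x hx => OverflowNetwork.overflowEq_unique hP.1 hQ.1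
    (hright g hg) hx hsol (hge x hx) (hge lam hsol), hu, K, hK, fun k x hx => ?_, hbound,
    fun hn => hbound.trans ?_⟩
  · have h1 := OverflowNetwork.RunsTo.le_of_unique_returned
      (fun c hc => OverflowNetwork.RunsTo.deterministic hu hc hK) hx
    have h2 := OverflowNetwork.RunsTo.le_of_unique_returned
      (fun c hc => OverflowNetwork.RunsTo.deterministic hu hc hx) hK
    obtain rfl := le_antisymm h1 h2
    exact ⟨rfl, by simpa using OverflowNetwork.RunsTo.deterministic hu hx hK⟩
  · have : n * (n + 1) / 2 + 1 ≤ n ^ 2 := by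
      -- Equivalent to `(n - 2) * (n + 1) ≥ 0`.
      have h3 : n * (n + 1) + 2 ≤ 2 * n ^ 2 := by nlinarith
      omega
    omega
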